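/- For a Borel probability measure $\mu$ on $\mathbb{R}$ let $$G_\mu(z)=\int_{\mathbb{R}}\frac{1}{z-x}\,\mu(\mathrm{d}x),\qquad F_\mu(z)=\frac{1}{G_\mu(z)},\qquad K_\mu(z)=z-F_\mu(z),\qquad \operatorname{Im} z>0.$$ The Boolean convolution $\mu\uplus\nu$ of two Borel probability measures on $\mathbb{R}$ is the unique Borel probability measure on $\mathbb{R}$ with $K_{\mu\uplus\nu}(z)=K_\mu(z)+K_\nu(z)$ for all $z$ with $\operatorname{Im} z>0$. For $c\in(0,1)$ let $D_c(\mu)$ be the push-forward of $\mu$ by $x\mapsto cx$. A Borel probability measure $\mu$ on $\mathbb{R}$ is called Boolean selfdecomposable if for every $c\in(0,1)$ there is a Borel probability measure $\mu_c$ on $\mathbb{R}$ such that $\mu=D_c(\mu)\uplus\mu_c$. **Theorem.** For every $v>0$ the normal distribution $N(0,v)$ with mean $0$ and variance $v$ is Boolean selfdecomposable. -/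

import Mathlib

open MeasureTheory ProbabilityTheory
open scoped NNReal

/-- The Cauchy transform `G_μ(z) = ∫ 1 / (z - x) μ(dx)`; it is used for `Im z > 0` only, where the
integrand is bounded and continuous in `x`. -/
noncomputable def cauchyTransform (μ : ProbabilityMeasure ℝ) (z : ℂ) : ℂ :=
  ∫ x : ℝ, 1 / (z - (x : ℂ)) ∂(μ : Measure ℝ)

/-- The `F`-transform `F_μ(z) = 1 / G_μ(z)`, used for `Im z > 0` only, where `G_μ(z) ≠ 0`. -/
noncomputable def fTransform (μ : ProbabilityMeasure ℝ) (z : ℂ) : ℂ :=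
  1 / cauchyTransform μ z

/-- The self-energy function `K_μ(z) = z - F_μ(z)`. -/
noncomputable def selfEnergy (μ : ProbabilityMeasure ℝ) (z : ℂ) : ℂ :=
  z - fTransform μ z

/-- `ρ = μ ⊎ ν`: the Boolean convolution of `μ` and `ν` is the (unique) probability measure `ρ`
with `K_ρ = K_μ + K_ν` on the open upper half-plane. -/
def IsBooleanConv (μ ν ρ : ProbabilityMeasure ℝ) : Prop :=
  ∀ z : ℂ, 0 < z.im → selfEnergy ρ z = selfEnergy μ z + selfEnergy ν z

/-- The dilation `D_c(μ)`: the push-forward of `μ` by `x ↦ c x`. -/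
noncomputable def dilation (c : ℝ) (μ : ProbabilityMeasure ℝ) : ProbabilityMeasure ℝ :=
  μ.map (f := fun x : ℝ => c * x) (measurable_const_mul c).aemeasurable

/-- `μ` is Boolean selfdecomposable: for every `c ∈ (0, 1)` there is a probability measure `μ_c`
with `μ = D_c(μ) ⊎ μ_c`. -/
def IsBooleanSelfdecomposable (μ : ProbabilityMeasure ℝ) : Prop :=
  ∀ c : ℝ, 0 < c → c < 1 → ∃ μc : ProbabilityMeasure ℝ, IsBooleanConv (dilation c μ) μc μ

/-- The normal distribution `N(m, v)` with mean `m` and variance `v`. -/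
noncomputable def normalDistribution (m : ℝ) (v : ℝ≥0) : ProbabilityMeasure ℝ :=
  ⟨gaussianReal m v, inferInstance⟩

open Complex Filter Topology Set
open scoped ComplexConjugate

/-! Dilation reduces the claim to variance 1. There `μ_c` must have self-energy `f(z) = K(z) - c
K(z/c)`, so the question is whether this `f` is the self-energy of a probability measure.

The Gaussian Cauchy transform extends to an entire function `G` with `G' = 1 - zG`
(`hasDerivAt_gaussCauchy`). `G` has no zero in the closed upper half-plane, and `zG - 1 = O(1/|z|)`
there. Hence `K = z - 1/G`, and with it `f`, is bounded and holomorphic up to the real line. By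
`exists_selfEnergy_eq` it then suffices that `Im f < 0` on the real line: Phragmén–Lindelöf carries
the sign inside, and `1/(z - f)` is the Cauchy transform of its own Stieltjes density.

On the real line write `G = H - iP`. The sign condition says `c Im (1/G)(x/c) < Im (1/G)(x)`, which
follows once `x / Im (1/G)(x) = x(H² + P²)/P` is strictly increasing. Since `H' = 1 - xH` and `P' =
-xP`, its derivative is `((1 - x²)(H² + P²) + 2xH)/P`, and `key_inequality` shows that the numerator
is positive. -/

/-! ### Cauchy's theorem and integral formula in the upper half-plane. -/

theorem isClosed_closedUpperHalfPlane : IsClosed {z : ℂ | 0 ≤ z.im} :=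
  isClosed_le continuous_const continuous_im

/-- A function continuous on the closed upper half-plane and bounded near infinity is bounded. -/
theorem exists_bound_of_continuousOn_of_tail {f : ℂ → ℂ} (hc : ContinuousOn f {z | 0 ≤ z.im})
    {M R : ℝ} (hM : ∀ z : ℂ, 0 ≤ z.im → R ≤ ‖z‖ → ‖f z‖ ≤ M) :
    ∃ B, ∀ z : ℂ, 0 ≤ z.im → ‖f z‖ ≤ B := by
  have hK : IsCompact ({z : ℂ | 0 ≤ z.im} ∩ Metric.closedBall 0 R) :=
    (isCompact_closedBall 0 R).inter_left isClosed_closedUpperHalfPlane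
  obtain ⟨B, hB⟩ := hK.exists_bound_of_continuousOn (hc.mono inter_subset_left)
  refine ⟨max B M, fun z hz => ?_⟩
  rcases le_total R ‖z‖ with h | h
  · exact (hM z hz h).trans (le_max_right _ _)
  · exact (hB z ⟨hz, by simpa using h⟩).trans (le_max_left _ _)

theorem integrable_ofReal_of_bound {f : ℂ → ℂ} (hc : ContinuousOn f {z | 0 ≤ z.im}) {C : ℝ}
    (hb : ∀ z : ℂ, 0 ≤ z.im → ‖f z‖ ≤ C / (1 + ‖z‖ ^ 2)) :
    Integrable (fun x : ℝ => f x) := by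
  have hcont : Continuous (fun x : ℝ => f x) :=
    hc.comp_continuous continuous_ofReal (fun x => by simp)
  refine (integrable_inv_one_add_sq.const_mul C).mono' hcont.aestronglyMeasurable
    (ae_of_all _ fun x => ?_)
  have := hb x (by simp)
  simpa [div_eq_mul_inv] using this

/-- Cauchy's theorem for the upper half-plane, for functions with quadratic decay. -/
theorem integral_ofReal_eq_zero_of_bound {f : ℂ → ℂ} (hc : ContinuousOn f {z | 0 ≤ z.im})
    (hd : DifferentiableOn ℂ f {z | 0 < z.im}) {C : ℝ}
    (hb : ∀ z : ℂ, 0 ≤ z.im → ‖f z‖ ≤ C / (1 + ‖z‖ ^ 2)) :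
    ∫ x : ℝ, f x = 0 := by
  have hC : 0 ≤ C := by
    have := (norm_nonneg _).trans (hb 0 (by simp))
    simpa using this
  have hlim : Tendsto (fun R : ℝ => ∫ x in (-R)..R, f x) atTop (𝓝 (∫ x : ℝ, f x)) :=
    intervalIntegral_tendsto_integral (integrable_ofReal_of_bound hc hb) tendsto_neg_atTop_atBot
      tendsto_id
  refine tendsto_nhds_unique hlim ?_
  -- In the rectangle `[-R, R] × [0, R]` the three sides off the real line have total length `4R`,
  -- and `‖f‖ ≤ C / R²` on them.
  have hzero : Tendsto (fun R : ℝ => 4 * C / R) atTop (𝓝 0) :=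
    tendsto_const_nhds.div_atTop tendsto_id
  refine squeeze_zero_norm' ?_ hzero
  filter_upwards [eventually_gt_atTop 0] with R hR
  have hbR : ∀ z : ℂ, 0 ≤ z.im → R ≤ ‖z‖ → ‖f z‖ ≤ C / R ^ 2 := by
    intro z hz hzR
    refine (hb z hz).trans ?_
    gcongr
    nlinarith
  have hrect := integral_boundary_rect_eq_zero_of_continuousOn_of_differentiableOn f
    (-R : ℂ) (R + R * I)
    (hc.mono (fun z hz => by
      have := hz.2
      simp [uIcc_of_le hR.le] at this
      exact this.1))
    (hd.mono (fun z hz => by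
      have := hz.2
      simp [hR.le] at this
      exact this.1))
  simp only [neg_re, ofReal_re, add_re, mul_re, I_re, mul_zero, ofReal_im, I_im, mul_one, sub_self,
    add_zero, neg_im, neg_zero, add_im, mul_im, zero_add, ofReal_zero, zero_mul] at hrect
  have h1 : ‖∫ x : ℝ in (-R)..R, f (x + R * I)‖ ≤ C / R ^ 2 * |R - -R| :=
    intervalIntegral.norm_integral_le_of_norm_le_const fun x _ => hbR _ (by simp [hR.le]) (by
      simpa [abs_of_pos hR] using abs_im_le_norm ((x : ℂ) + R * I))
  have h2 : ‖∫ y : ℝ in (0:ℝ)..R, f (R + y * I)‖ ≤ C / R ^ 2 * |R - 0| :=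
    intervalIntegral.norm_integral_le_of_norm_le_const fun y hy => hbR _ (by
      rw [uIoc_of_le hR.le] at hy; simp [hy.1.le]) (by
      simpa [abs_of_pos hR] using abs_re_le_norm ((R : ℂ) + y * I))
  have h3 : ‖∫ y : ℝ in (0:ℝ)..R, f ((-R : ℝ) + y * I)‖ ≤ C / R ^ 2 * |R - 0| :=
    intervalIntegral.norm_integral_le_of_norm_le_const fun y hy => hbR _ (by
      rw [uIoc_of_le hR.le] at hy; simp [hy.1.le]) (by
      simpa [abs_of_pos hR] using abs_re_le_norm (((-R : ℝ) : ℂ) + y * I))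
  have heq : ∫ x in (-R)..R, f x = (∫ x : ℝ in (-R)..R, f (x + R * I)) -
      I • (∫ y : ℝ in (0:ℝ)..R, f (R + y * I)) + I • ∫ y : ℝ in (0:ℝ)..R, f ((-R : ℝ) + y * I) := by
    linear_combination hrect
  rw [heq]
  refine (norm_add_le _ _).trans ((add_le_add_left (norm_sub_le _ _) _).trans ?_)
  rw [norm_smul, norm_smul, norm_I, one_mul, one_mul]
  refine (add_le_add (add_le_add h1 h2) h3).trans (le_of_eq ?_)
  rw [sub_neg_eq_add, sub_zero, abs_of_pos hR, abs_of_pos (by linarith)]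
  field_simp
  ring

/-- The denominator is `(x - Re z)² + (Im z)²`, so this is a rescaled arctangent integral.
Multiplied by `z - conj z` it gives the `2πi` of the Cauchy formula without residues. -/
theorem integral_inv_sub_mul_inv_sub_conj {z : ℂ} (hz : 0 < z.im) :
    ∫ x : ℝ, 1 / (((x : ℂ) - z) * (x - conj z)) = (Real.pi / z.im : ℝ) := by
  have h (x : ℝ) : 1 / (((x : ℂ) - z) * (x - conj z)) =
      (((z.im ^ 2)⁻¹ * (1 + ((x - z.re) / z.im) ^ 2)⁻¹ : ℝ) : ℂ) := by
    have h1 : ((x : ℂ) - z) * (x - conj z) = (((x - z.re) ^ 2 + z.im ^ 2 : ℝ) : ℂ) := by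
      apply Complex.ext
      · simp [pow_two]
      · simp [pow_two]
        ring
    rw [h1, ← ofReal_one, ← ofReal_div, ← mul_inv]
    congr 1
    field_simp
    ring
  simp_rw [h]
  rw [integral_complex_ofReal, integral_const_mul,
    integral_sub_right_eq_self (fun x : ℝ => (1 + (x / z.im) ^ 2)⁻¹) z.re,
    Measure.integral_comp_div (fun x : ℝ => (1 + x ^ 2)⁻¹), integral_univ_inv_one_add_sq,
    abs_of_pos hz]
  congr 1
  simp only [smul_eq_mul]
  field_simp

/-- The point `conj z` lies at distance at least `Im z` from the closed upper half-plane; dividing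
by `w - conj z` thus improves decay `O(1/|w|)` to `O(1/|w|²)`. -/
theorem one_add_norm_le_mul_norm_sub_conj {z : ℂ} (hz : 0 < z.im) {w : ℂ} (hw : 0 ≤ w.im) :
    1 + ‖w‖ ≤ ((1 + ‖z‖) / z.im + 1) * ‖w - conj z‖ := by
  have h1 : z.im ≤ ‖w - conj z‖ := by
    have := abs_im_le_norm (w - conj z)
    simp only [sub_im, conj_im, sub_neg_eq_add] at this
    exact (by linarith : z.im ≤ w.im + z.im).trans ((le_abs_self _).trans this)
  have h2 : ‖w‖ ≤ ‖w - conj z‖ + ‖z‖ := by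
    have := norm_sub_norm_le w (conj z)
    rw [norm_conj] at this
    linarith
  have h3 : 1 + ‖z‖ ≤ (1 + ‖z‖) / z.im * ‖w - conj z‖ := by
    rw [div_mul_eq_mul_div, le_div_iff₀ hz]
    gcongr
  linarith

theorem sub_conj_ne_zero {z : ℂ} (hz : 0 < z.im) {w : ℂ} (hw : 0 ≤ w.im) : w - conj z ≠ 0 := by
  intro h
  have := congrArg im h
  simp at this
  linarith


theorem continuousOn_div_sub_conj {g : ℂ → ℂ} (hc : ContinuousOn g {z | 0 ≤ z.im}) {z : ℂ}
    (hz : 0 < z.im) : ContinuousOn (fun w => g w / (w - conj z)) {z | 0 ≤ z.im} :=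
  hc.div (by fun_prop) fun _ hw => sub_conj_ne_zero hz hw

theorem exists_bound_div_sub_conj {g : ℂ → ℂ} {C : ℝ}
    (hb : ∀ z : ℂ, 0 ≤ z.im → ‖g z‖ ≤ C / (1 + ‖z‖)) {z : ℂ} (hz : 0 < z.im) :
    ∃ D, ∀ w : ℂ, 0 ≤ w.im → ‖g w / (w - conj z)‖ ≤ D / (1 + ‖w‖ ^ 2) := by
  have hC : 0 ≤ C := by
    have := (norm_nonneg _).trans (hb 0 (by simp))
    simpa using this
  refine ⟨C * ((1 + ‖z‖) / z.im + 1), fun w hw => ?_⟩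
  have h0 : 0 < ‖w - conj z‖ := norm_pos_iff.2 (sub_conj_ne_zero hz hw)
  have h1 := one_add_norm_le_mul_norm_sub_conj hz hw
  have h2 := hb w hw
  have h3 := norm_nonneg w
  rw [le_div_iff₀ (by positivity)] at h2
  rw [norm_div, div_le_div_iff₀ h0 (by positivity)]
  calc ‖g w‖ * (1 + ‖w‖ ^ 2) ≤ ‖g w‖ * ((1 + ‖w‖) * (1 + ‖w‖)) := by gcongr; nlinarith
    _ = (‖g w‖ * (1 + ‖w‖)) * (1 + ‖w‖) := by ring
    _ ≤ C * (((1 + ‖z‖) / z.im + 1) * ‖w - conj z‖) := by gcongr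
    _ = _ := by ring

/-- The Cauchy integral formula for the upper half-plane. -/
theorem integral_div_sub_eq {g : ℂ → ℂ} (hc : ContinuousOn g {z | 0 ≤ z.im})
    (hd : DifferentiableOn ℂ g {z | 0 < z.im}) {C : ℝ}
    (hb : ∀ z : ℂ, 0 ≤ z.im → ‖g z‖ ≤ C / (1 + ‖z‖)) {z : ℂ} (hz : 0 < z.im) :
    Integrable (fun x : ℝ => g x / (x - z)) ∧
      ∫ x : ℝ, g x / (x - z) = 2 * Real.pi * I * g z := by
  have hC : 0 ≤ C := by
    have := (norm_nonneg _).trans (hb 0 (by simp))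
    simpa using this
  have hopen : IsOpen {z : ℂ | 0 < z.im} := isOpen_lt continuous_const continuous_im
  have hzn : {z : ℂ | 0 < z.im} ∈ 𝓝 z := hopen.mem_nhds hz
  have hzn' : {z : ℂ | 0 ≤ z.im} ∈ 𝓝 z := mem_of_superset hzn fun w (hw : 0 < w.im) => hw.le
  -- As `p` vanishes at `z`, the quotient `f = p / ((w - z)(w - conj z))` has no pole. It equals
  -- `g/(w - z)` minus a multiple of the explicit kernel, and it decays quadratically, so its
  -- integral is zero.
  set p : ℂ → ℂ := fun w => g w * (w - conj z) - g z * (z - conj z) with hp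
  have hpz : p z = 0 := by simp [hp]
  have hpc : ContinuousOn p {z | 0 ≤ z.im} := (hc.mul (by fun_prop)).sub continuousOn_const
  have hpd : DifferentiableOn ℂ p {z | 0 < z.im} := (hd.mul (by fun_prop)).sub_const _
  set f : ℂ → ℂ := fun w => dslope p z w / (w - conj z) with hf
  have hfc : ContinuousOn f {z | 0 ≤ z.im} :=
    continuousOn_div_sub_conj ((continuousOn_dslope hzn').2 ⟨hpc, hpd.differentiableAt hzn⟩) hz
  have hfd : DifferentiableOn ℂ f {z | 0 < z.im} :=
    ((differentiableOn_dslope hzn).2 hpd).div (by fun_prop) fun w hw =>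
      sub_conj_ne_zero hz (le_of_lt hw)
  have hfne (w : ℂ) (hw : w ≠ z) : f w = p w / ((w - z) * (w - conj z)) := by
    simp only [hf, dslope_of_ne _ hw, slope_def_field, hpz, sub_zero, div_div]
  obtain ⟨P, hP⟩ : ∃ P, ∀ w : ℂ, 0 ≤ w.im → ‖p w‖ ≤ P := by
    refine ⟨C * (1 + ‖z‖) + ‖g z * (z - conj z)‖, fun w hw => (norm_sub_le _ _).trans ?_⟩
    gcongr
    rw [norm_mul]
    have h2 := hb w hw
    have h3 := norm_nonneg w
    have h4 := norm_nonneg z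
    rw [le_div_iff₀ (by positivity)] at h2
    have h5 : ‖w - conj z‖ ≤ ‖w‖ + ‖z‖ := by simpa using norm_sub_le w (conj z)
    calc ‖g w‖ * ‖w - conj z‖ ≤ ‖g w‖ * ((1 + ‖w‖) * (1 + ‖z‖)) := by
          gcongr; nlinarith [mul_nonneg h3 h4]
      _ = (‖g w‖ * (1 + ‖w‖)) * (1 + ‖z‖) := by ring
      _ ≤ _ := by gcongr
  have hP0 : 0 ≤ P := (norm_nonneg _).trans (hP z hz.le)
  obtain ⟨D, hD⟩ : ∃ D, ∀ w : ℂ, 0 ≤ w.im → ‖((1 + ‖w‖ ^ 2 : ℝ) : ℂ) * f w‖ ≤ D := by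
    refine exists_bound_of_continuousOn_of_tail
      (ContinuousOn.mul (Continuous.continuousOn (by fun_prop)) hfc)
      (M := 8 * P) (R := 2 * ‖z‖ + 1) fun w hw hR => ?_
    have hz0 := norm_nonneg z
    have hwz : w ≠ z := by
      rintro rfl
      linarith
    have h1 : ‖w‖ / 2 ≤ ‖w - z‖ := by have := norm_sub_norm_le w z; linarith
    have h2 : ‖w‖ / 2 ≤ ‖w - conj z‖ := by
      have := norm_sub_norm_le w (conj z)
      rw [norm_conj] at this
      linarith
    have hw0 : 0 < ‖w‖ := by linarith
    have hpos : (0 : ℝ) ≤ 1 + ‖w‖ ^ 2 := by positivity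
    rw [hfne w hwz, norm_mul, norm_real, Real.norm_of_nonneg hpos, norm_div, norm_mul,
      ← mul_div_assoc, div_le_iff₀ (by
        have : 0 < ‖w‖ / 2 := by linarith
        exact mul_pos (this.trans_le h1) (this.trans_le h2))]
    calc (1 + ‖w‖ ^ 2) * ‖p w‖ ≤ (2 * ‖w‖ ^ 2) * P := by
          gcongr
          · nlinarith
          · exact hP w hw
      _ = 8 * P * (‖w‖ / 2 * (‖w‖ / 2)) := by ring
      _ ≤ _ := by gcongr
  have hfb (w : ℂ) (hw : 0 ≤ w.im) : ‖f w‖ ≤ D / (1 + ‖w‖ ^ 2) := by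
    have hpos : (0 : ℝ) < 1 + ‖w‖ ^ 2 := by positivity
    have := hD w hw
    rw [norm_mul, norm_real, Real.norm_of_nonneg hpos.le] at this
    rwa [le_div_iff₀' hpos]
  have hne (x : ℝ) : (x : ℂ) - z ≠ 0 := by
    intro h
    have := congrArg im h
    simp at this
    linarith
  -- A nonintegrable function has integral `0` by convention, but this integral is `π / Im z > 0`.
  have hkint : Integrable (fun x : ℝ => 1 / (((x : ℂ) - z) * (x - conj z))) := by
    by_contra h
    have h1 := integral_inv_sub_mul_inv_sub_conj hz
    rw [integral_undef h] at h1
    have : (0 : ℝ) < Real.pi / z.im := by positivity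
    exact this.ne (by exact_mod_cast h1)
  have hfx (x : ℝ) : g x / (x - z) =
      f x + g z * (z - conj z) * (1 / (((x : ℂ) - z) * (x - conj z))) := by
    have h1 := hne x
    have h2 := sub_conj_ne_zero hz (w := x) (by simp)
    rw [hfne x (sub_ne_zero.1 h1), hp]
    field_simp
    ring
  have hfi := integrable_ofReal_of_bound hfc hfb
  simp_rw [hfx]
  refine ⟨hfi.add (hkint.const_mul _), ?_⟩
  rw [integral_add hfi (hkint.const_mul _), integral_ofReal_eq_zero_of_bound hfc hfd hfb,
    integral_const_mul, integral_inv_sub_mul_inv_sub_conj hz, sub_conj]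
  have : (z.im : ℂ) ≠ 0 := by exact_mod_cast hz.ne'
  push_cast
  field_simp
  ring

/-! ### Recovering a probability measure from boundary values. -/

/-- A function holomorphic in the upper half-plane, continuous up to the real line and with decay
`O(1/|z|)`, is the Cauchy transform of its Stieltjes density. -/
theorem integral_neg_im_div_sub_eq {g : ℂ → ℂ} (hc : ContinuousOn g {z | 0 ≤ z.im})
    (hd : DifferentiableOn ℂ g {z | 0 < z.im}) {C : ℝ}
    (hb : ∀ z : ℂ, 0 ≤ z.im → ‖g z‖ ≤ C / (1 + ‖z‖)) {z : ℂ} (hz : 0 < z.im) :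
    Integrable (fun x : ℝ => ((-(g x).im / Real.pi : ℝ) : ℂ) * (1 / (z - x))) ∧
      ∫ x : ℝ, ((-(g x).im / Real.pi : ℝ) : ℂ) * (1 / (z - x)) = g z := by
  obtain ⟨hi, he⟩ := integral_div_sub_eq hc hd hb hz
  obtain ⟨D, hD⟩ := exists_bound_div_sub_conj hb hz
  have hc' := continuousOn_div_sub_conj hc hz
  have hd' : DifferentiableOn ℂ (fun w => g w / (w - conj z)) {z | 0 < z.im} :=
    hd.div (by fun_prop) fun w hw => sub_conj_ne_zero hz (le_of_lt hw)
  -- The pole `conj z` is outside the half-plane. Conjugating this vanishing integral lets `g` be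
  -- replaced by `g - conj g = 2i Im g` in the Cauchy formula.
  have h0 := integral_ofReal_eq_zero_of_bound hc' hd' hD
  have hi' := integrable_ofReal_of_bound hc' hD
  have hconj : Integrable (fun x : ℝ => conj (g x / (x - conj z))) :=
    (ContinuousLinearEquiv.integrable_comp_iff (L := conjCLE.toContinuousLinearEquiv)).2 hi'
  have h0' : ∫ x : ℝ, conj (g x / (x - conj z)) = 0 := by
    rw [integral_conj, h0, map_zero]
  have hpi : (Real.pi : ℂ) ≠ 0 := by exact_mod_cast Real.pi_ne_zero
  have hx (x : ℝ) : ((-(g x).im / Real.pi : ℝ) : ℂ) * (1 / (z - x)) =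
      (2 * Real.pi * I)⁻¹ * (g x / (x - z) - conj (g x / (x - conj z))) := by
    have hne : (x : ℂ) - z ≠ 0 := by
      intro h
      have := congrArg im h
      simp at this
      linarith
    have hne' : z - (x : ℂ) ≠ 0 := by rwa [← neg_sub, neg_ne_zero]
    have him : g x - conj (g x) = 2 * (g x).im * I := by rw [sub_conj]; push_cast; ring
    rw [map_div₀, map_sub, conj_conj, conj_ofReal, ← sub_div, him, ← neg_sub z (x : ℂ)]
    push_cast
    field_simp
  simp_rw [hx]
  refine ⟨(hi.sub hconj).const_mul _, ?_⟩
  rw [integral_const_mul, integral_sub hi hconj, he, h0', sub_zero]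
  have := I_ne_zero
  field_simp

/-- This weight increases to `1` as `y → ∞`, so monotone convergence yields the total mass of the
density. -/
theorem re_mul_I_mul_inv_sub (y x : ℝ) :
    ((y * I) * (1 / (y * I - x))).re = y ^ 2 / (y ^ 2 + x ^ 2) := by
  simp [div_eq_mul_inv, normSq_apply]
  ring

/-- A function holomorphic in the upper half-plane, continuous up to the real line with
nonpositive imaginary part there, and asymptotic to `1/z`, is a Cauchy transform of a probability
measure. -/
theorem exists_probabilityMeasure_cauchyTransform_eq {g : ℂ → ℂ}
    (hc : ContinuousOn g {z | 0 ≤ z.im}) (hd : DifferentiableOn ℂ g {z | 0 < z.im}) {C : ℝ}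
    (hb : ∀ z : ℂ, 0 ≤ z.im → ‖g z‖ ≤ C / (1 + ‖z‖))
    (him : ∀ x : ℝ, (g x).im ≤ 0)
    (hlim : Tendsto (fun y : ℝ => y * I * g (y * I)) atTop (𝓝 1)) :
    ∃ μ : ProbabilityMeasure ℝ, ∀ z : ℂ, 0 < z.im → cauchyTransform μ z = g z := by
  set ρ : ℝ → ℝ := fun x => -(g x).im / Real.pi with hρ
  have hρ0 (x : ℝ) : 0 ≤ ρ x := div_nonneg (neg_nonneg.2 (him x)) Real.pi_pos.le
  have hρc : Continuous ρ := by
    have : Continuous (fun x : ℝ => g x) :=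
      hc.comp_continuous continuous_ofReal (fun x => by simp)
    exact (continuous_im.comp this).neg.div_const _
  have key (y : ℝ) (hy : 0 < y) : Integrable (fun x => ρ x * (y ^ 2 / (y ^ 2 + x ^ 2))) ∧
      ∫ x, ρ x * (y ^ 2 / (y ^ 2 + x ^ 2)) = (y * I * g (y * I)).re := by
    obtain ⟨h1, h2⟩ := integral_neg_im_div_sub_eq hc hd hb (z := y * I) (by simpa using hy)
    have h3 (x : ℝ) : ρ x * (y ^ 2 / (y ^ 2 + x ^ 2)) =
        (y * I * ((ρ x : ℂ) * (1 / (y * I - x)))).re := by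
      rw [mul_left_comm, re_ofReal_mul, re_mul_I_mul_inv_sub]
    have h4 := h1.const_mul (y * I : ℂ)
    simp_rw [h3]
    refine ⟨h4.re, ?_⟩
    rw [← h2, ← integral_const_mul]
    exact integral_re h4
  have hmono : Tendsto (fun n : ℕ => ∫⁻ x, ENNReal.ofReal
      (ρ x * (((n : ℝ) + 1) ^ 2 / (((n : ℝ) + 1) ^ 2 + x ^ 2)))) atTop
      (𝓝 (∫⁻ x, ENNReal.ofReal (ρ x))) := by
    refine lintegral_tendsto_of_tendsto_of_monotone (fun n => ?_) (ae_of_all _ fun x => ?_)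
      (ae_of_all _ fun x => ?_)
    · exact ((key (n + 1) (by positivity)).1.aestronglyMeasurable.aemeasurable.ennreal_ofReal).congr
        (by simp)
    · intro m n hmn
      refine ENNReal.ofReal_le_ofReal (mul_le_mul_of_nonneg_left ?_ (hρ0 x))
      rw [div_le_div_iff₀ (by positivity) (by positivity)]
      have : ((m : ℝ) + 1) ^ 2 ≤ ((n : ℝ) + 1) ^ 2 := by gcongr
      nlinarith [mul_le_mul_of_nonneg_right this (sq_nonneg x)]
    · refine ENNReal.tendsto_ofReal ?_
      have h1 : Tendsto (fun n : ℕ => ((n : ℝ) + 1) ^ 2) atTop atTop :=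
        (tendsto_pow_atTop two_ne_zero).comp
          (tendsto_atTop_add_const_right _ _ tendsto_natCast_atTop_atTop)
      have h2 : Tendsto (fun t : ℝ => t / (t + x ^ 2)) atTop (𝓝 1) := by
        have h3 : Tendsto (fun t : ℝ => 1 - x ^ 2 / (t + x ^ 2)) atTop (𝓝 (1 - 0)) :=
          tendsto_const_nhds.sub (tendsto_const_nhds.div_atTop
            (tendsto_atTop_add_const_right _ _ tendsto_id))
        rw [sub_zero] at h3
        refine h3.congr' ?_
        filter_upwards [eventually_gt_atTop 0] with t ht
        have : t + x ^ 2 ≠ 0 := by positivity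
        field_simp
        ring
      simpa using (h2.comp h1).const_mul (ρ x)
  have hone : ∫⁻ x, ENNReal.ofReal (ρ x) = 1 := by
    refine tendsto_nhds_unique hmono ?_
    have h1 : Tendsto (fun n : ℕ => ENNReal.ofReal
        ((((n : ℝ) + 1 : ℝ) * I * g (((n : ℝ) + 1 : ℝ) * I)).re)) atTop (𝓝 1) := by
      rw [← ENNReal.ofReal_one, ← one_re]
      exact ENNReal.tendsto_ofReal ((continuous_re.tendsto _).comp (hlim.comp
        (tendsto_atTop_add_const_right _ _ tendsto_natCast_atTop_atTop)))
    refine h1.congr fun n => ?_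
    obtain ⟨h2, h3⟩ := key (n + 1) (by positivity)
    rw [← h3, ofReal_integral_eq_lintegral_ofReal h2
      (ae_of_all _ fun x => mul_nonneg (hρ0 x) (by positivity))]
  have hprob : IsProbabilityMeasure (volume.withDensity fun x => ENNReal.ofReal (ρ x)) :=
    ⟨by rw [withDensity_apply _ MeasurableSet.univ, setLIntegral_univ, hone]⟩
  refine ⟨⟨_, hprob⟩, fun z hz => ?_⟩
  rw [← (integral_neg_im_div_sub_eq hc hd hb hz).2]
  change ∫ x : ℝ, 1 / (z - (x : ℂ)) ∂(volume.withDensity fun x => ENNReal.ofReal (ρ x)) = _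
  rw [integral_withDensity_eq_integral_toReal_smul hρc.measurable.ennreal_ofReal
    (ae_of_all _ fun x => ENNReal.ofReal_lt_top)]
  refine integral_congr_ae (ae_of_all _ fun x => ?_)
  simp only [ENNReal.toReal_ofReal (hρ0 x), real_smul]
  rfl

/-! ### Real inequalities for the primitive `h` of `exp (x²/2)`. -/

theorem hasDerivAt_exp_half_sq (x : ℝ) :
    HasDerivAt (fun x => Real.exp (x ^ 2 / 2)) (x * Real.exp (x ^ 2 / 2)) x := by
  have := (((hasDerivAt_id x).pow 2).div_const 2).exp
  simp only [id_eq, Pi.pow_apply] at this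
  convert this using 1
  push_cast
  ring

theorem le_of_hasDerivAt_nonneg {f f' : ℝ → ℝ} (hf : ∀ x, HasDerivAt f (f' x) x)
    (hf' : ∀ x, 0 < x → 0 ≤ f' x) {x : ℝ} (hx : 0 ≤ x) : f 0 ≤ f x := by
  refine monotoneOn_of_deriv_nonneg (convex_Ici 0) (fun y _ => (hf y).continuousAt.continuousWithinAt)
    (fun y _ => (hf y).differentiableAt.differentiableWithinAt) (fun y hy => ?_) self_mem_Ici hx hx
  rw [interior_Ici] at hy
  rw [(hf y).deriv]
  exact hf' y hy


theorem odd_of_hasDerivAt_exp_half_sq {h : ℝ → ℝ}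
    (hh : ∀ x, HasDerivAt h (Real.exp (x ^ 2 / 2)) x) (h0 : h 0 = 0) (x : ℝ) : h (-x) = -h x := by
  have h1 (y : ℝ) : HasDerivAt (fun y => h y + h (-y)) 0 y := by
    have := (hh y).add ((hh (-y)).comp y (hasDerivAt_neg y))
    convert! this using 1
    rw [neg_sq]; ring
  have := is_const_of_deriv_eq_zero (fun y => (h1 y).differentiableAt) (fun y => (h1 y).deriv) x 0
  simp only [neg_zero, h0, add_zero] at this
  linarith

theorem self_le_of_hasDerivAt_exp_half_sq {h : ℝ → ℝ}
    (hh : ∀ x, HasDerivAt h (Real.exp (x ^ 2 / 2)) x) (h0 : h 0 = 0) {x : ℝ} (hx : 0 ≤ x) :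
    x ≤ h x := by
  have := le_of_hasDerivAt_nonneg (fun x => (hh x).sub (hasDerivAt_id x))
    (fun x _ => sub_nonneg.2 (Real.one_le_exp (by positivity))) hx
  simp only [Pi.sub_apply, id_eq, h0] at this
  linarith

/-- The difference of the two sides has derivative `x² exp (x²/2)`. -/
theorem le_self_mul_exp_of_hasDerivAt_exp_half_sq {h : ℝ → ℝ}
    (hh : ∀ x, HasDerivAt h (Real.exp (x ^ 2 / 2)) x) (h0 : h 0 = 0) {x : ℝ} (hx : 0 ≤ x) :
    h x ≤ x * Real.exp (x ^ 2 / 2) := by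
  have := le_of_hasDerivAt_nonneg
    (fun x => ((hasDerivAt_id x).mul (hasDerivAt_exp_half_sq x)).sub (hh x))
    (fun x _ => by
      have : (1 * Real.exp (x ^ 2 / 2) + id x * (x * Real.exp (x ^ 2 / 2)) - Real.exp (x ^ 2 / 2))
        = x ^ 2 * Real.exp (x ^ 2 / 2) := by simp only [id_eq]; ring
      rw [this]; positivity) hx
  simp only [Pi.sub_apply, Pi.mul_apply, id_eq, h0] at this
  linarith

/-- The difference has derivative `x exp (x²/2) - h x`, nonnegative by the preceding bound. -/
theorem self_mul_le_of_hasDerivAt_exp_half_sq {h : ℝ → ℝ}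
    (hh : ∀ x, HasDerivAt h (Real.exp (x ^ 2 / 2)) x) (h0 : h 0 = 0) {x : ℝ} (hx : 0 ≤ x) :
    x * h x ≤ 2 * (Real.exp (x ^ 2 / 2) - 1) := by
  have := le_of_hasDerivAt_nonneg
    (fun x => (((hasDerivAt_exp_half_sq x).sub_const 1).const_mul 2).sub
      ((hasDerivAt_id x).mul (hh x)))
    (fun x hx => by
      have := le_self_mul_exp_of_hasDerivAt_exp_half_sq hh h0 hx.le
      simp only [id_eq]
      linarith) hx
  simp only [Pi.sub_apply, Pi.mul_apply, id_eq, h0] at this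
  norm_num at this
  linarith

/-- The difference has derivative `h x - x exp (-x²/2)`, nonnegative since `x ≤ h x`. -/
theorem le_self_mul_of_hasDerivAt_exp_half_sq {h : ℝ → ℝ}
    (hh : ∀ x, HasDerivAt h (Real.exp (x ^ 2 / 2)) x) (h0 : h 0 = 0) {x : ℝ} (hx : 0 ≤ x) :
    Real.exp (x ^ 2 / 2) - (Real.exp (x ^ 2 / 2))⁻¹ ≤ x * h x := by
  have := le_of_hasDerivAt_nonneg
    (fun x => ((hasDerivAt_id x).mul (hh x)).sub ((hasDerivAt_exp_half_sq x).sub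
      ((hasDerivAt_exp_half_sq x).fun_inv (Real.exp_pos _).ne')))
    (fun x hx => by
      have h1 := self_le_of_hasDerivAt_exp_half_sq hh h0 hx.le
      have h2 : (1 : ℝ) ≤ Real.exp (x ^ 2 / 2) := Real.one_le_exp (by positivity)
      have h3 : -(x * Real.exp (x ^ 2 / 2)) / Real.exp (x ^ 2 / 2) ^ 2
          = -(x / Real.exp (x ^ 2 / 2)) := by field_simp
      have h4 : x / Real.exp (x ^ 2 / 2) ≤ x := div_le_self hx.le h2
      rw [h3]
      simp only [id_eq]
      linarith) hx
  simp only [Pi.sub_apply, Pi.mul_apply, id_eq, h0] at this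
  norm_num at this
  linarith

/-- The inequality behind the monotonicity of `x (H² + P²) / P`. -/
theorem key_inequality {H : ℝ → ℝ} (hH : ∀ x, HasDerivAt H (1 - x * H x) x) (hH0 : H 0 = 0)
    (x : ℝ) :
    0 < (1 - x ^ 2) * (H x ^ 2 + Real.pi / 2 * (Real.exp (x ^ 2 / 2))⁻¹ ^ 2) + 2 * x * H x := by
  set h : ℝ → ℝ := fun x => Real.exp (x ^ 2 / 2) * H x with hdef
  have hh (x : ℝ) : HasDerivAt h (Real.exp (x ^ 2 / 2)) x := by
    convert! (hasDerivAt_exp_half_sq x).mul (hH x) using 1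
    ring
  have h0 : h 0 = 0 := by simp [hdef, hH0]
  have hodd (x : ℝ) : H (-x) = -H x := by
    have := odd_of_hasDerivAt_exp_half_sq hh h0 x
    simp only [hdef, neg_sq, ← mul_neg] at this
    exact mul_left_cancel₀ (Real.exp_pos _).ne' this
  -- The expression is even because `H` is odd.
  wlog hx : 0 ≤ x generalizing x
  · have := this (-x) (by linarith)
    rw [hodd] at this
    simpa using this
  have hHe : h x = Real.exp (x ^ 2 / 2) * H x := rfl
  have b1 := self_le_of_hasDerivAt_exp_half_sq hh h0 hx
  have b2 := self_mul_le_of_hasDerivAt_exp_half_sq hh h0 hx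
  have b3 := le_self_mul_of_hasDerivAt_exp_half_sq hh h0 hx
  have hE : 0 < Real.exp (x ^ 2 / 2) := Real.exp_pos _
  -- This is `e t ≤ exp t`, the tangent line at `t = 1`, with `t = x²/2`.
  have hEu : Real.exp 1 * (x ^ 2 / 2) ≤ Real.exp (x ^ 2 / 2) := by
    have := Real.add_one_le_exp (x ^ 2 / 2 - 1)
    have h2 : Real.exp (x ^ 2 / 2) = Real.exp 1 * Real.exp (x ^ 2 / 2 - 1) := by
      rw [← Real.exp_add]; congr 1; ring
    rw [h2]
    gcongr
    linarith
  have hE1 : 1 < x → Real.exp 1 ≤ Real.exp (x ^ 2 / 2) ^ 2 := fun hx1 => by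
    rw [← Real.exp_nat_mul]
    refine Real.exp_le_exp.2 ?_
    push_cast
    nlinarith
  rw [hHe] at b1 b2 b3
  generalize Real.exp (x ^ 2 / 2) = E at *
  have hH0 : 0 ≤ H x := by
    by_contra hneg
    nlinarith [mul_pos hE (neg_pos.2 (not_le.1 hneg))]
  have hpi := Real.pi_pos
  rcases lt_or_ge x 1 with hx1 | hx1
  · have : 0 < 1 - x ^ 2 := by nlinarith
    have : 0 ≤ 2 * x * H x := by positivity
    positivity
  rcases hx1.eq_or_lt with rfl | hx1
  · have : 0 < H 1 := by
      by_contra hneg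
      nlinarith
    norm_num
    exact this
  have hE1 := hE1 hx1
  set s := x * H x with hs
  have b2' : s ≤ 2 - 2 * E⁻¹ := by
    have : E * s ≤ E * (2 - 2 * E⁻¹) := by
      have : E * (2 - 2 * E⁻¹) = 2 * (E - 1) := by field_simp
      linarith
    exact le_of_mul_le_mul_left this hE
  have b3' : 1 - E⁻¹ ^ 2 ≤ s := by
    have : E * (1 - E⁻¹ ^ 2) ≤ E * s := by
      have : E * (1 - E⁻¹ ^ 2) = E - E⁻¹ := by field_simp
      linarith
    exact le_of_mul_le_mul_left this hE
  set r := E⁻¹ with hr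
  have hr0 : 0 < r := inv_pos.2 hE
  have he : 2.718 < Real.exp 1 := by linarith [Real.exp_one_gt_d9]
  have hpi' := Real.pi_lt_d2
  have c1 : r ^ 2 * 2.718 ≤ 1 := by
    have : r ^ 2 * 2.718 ≤ r ^ 2 * E ^ 2 := by gcongr; linarith
    rwa [← mul_pow, hr, inv_mul_cancel₀ hE.ne', one_pow] at this
  have c2 : r * (2.718 * (x ^ 2 / 2)) ≤ 1 := by
    have : r * (2.718 * (x ^ 2 / 2)) ≤ r * E := by
      gcongr
      refine le_trans ?_ hEu
      gcongr
    rwa [hr, inv_mul_cancel₀ hE.ne'] at this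
  have d1 : (1 - r ^ 2) * (2 * r) ≤ s * (2 - s) :=
    mul_le_mul b3' (by linarith) (by linarith) (by nlinarith)
  -- After cancelling `r`: `π/2 < 1.575` and `r x² ≤ 2/2.718 < 0.736` keep the left side below
  -- `1.16`, while `r² ≤ 1/2.718` keeps `2(1 - r²)` above `1.26`.
  have d2 : (x ^ 2 - 1) * (Real.pi / 2 * r ^ 2) < (1 - r ^ 2) * (2 * r) := by
    have e1 : Real.pi / 2 * (r * (x ^ 2 - 1)) ≤ 1.575 * 0.736 := by
      refine mul_le_mul (by linarith) ?_ (mul_nonneg hr0.le (by nlinarith)) (by norm_num)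
      nlinarith
    have e2 : (x ^ 2 - 1) * (Real.pi / 2 * r ^ 2) = (Real.pi / 2 * (r * (x ^ 2 - 1))) * r := by ring
    rw [e2, ← mul_assoc (1 - r ^ 2)]
    refine mul_lt_mul_of_pos_right ?_ hr0
    nlinarith
  have : (1 - x ^ 2) * (H x ^ 2 + Real.pi / 2 * r ^ 2) + 2 * x * H x =
      H x ^ 2 + s * (2 - s) - (x ^ 2 - 1) * (Real.pi / 2 * r ^ 2) := by
    rw [hs]; ring
  rw [this]
  nlinarith [sq_nonneg (H x)]


/-! ### The Gaussian Cauchy transform as an entire function. -/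

/-- The kernel `exp (i z t - t² / 2)`. -/
noncomputable def gaussKernel (z : ℂ) (t : ℝ) : ℂ :=
  cexp (-(t : ℂ) ^ 2 / 2 + I * z * t)

/-- The entire extension of the Cauchy transform of the standard normal distribution. -/
noncomputable def gaussCauchy (z : ℂ) : ℂ :=
  -I * ∫ t in Ioi (0 : ℝ), gaussKernel z t

theorem norm_gaussKernel (z : ℂ) (t : ℝ) :
    ‖gaussKernel z t‖ = Real.exp (-t ^ 2 / 2 - z.im * t) := by
  rw [gaussKernel, norm_exp]
  congr 1
  have : (-(t : ℂ) ^ 2 / 2) = ((-t ^ 2 / 2 : ℝ) : ℂ) := by push_cast; ring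
  rw [add_re, this, ofReal_re]
  simp
  ring

theorem continuous_gaussKernel (z : ℂ) : Continuous (gaussKernel z) := by
  unfold gaussKernel
  fun_prop

theorem integrable_gaussKernel (z : ℂ) : Integrable (gaussKernel z) := by
  have := integrable_cexp_quadratic' (b := -1 / 2) (by norm_num) (I * z) 0
  refine this.congr (ae_of_all _ fun t => ?_)
  simp only [gaussKernel]
  congr 1
  ring

/-- Since `tⁿ ≤ n! exp t`, the power is absorbed by moving `z` down to `z - I`. -/
theorem integrableOn_pow_mul_gaussKernel (n : ℕ) (z : ℂ) :
    IntegrableOn (fun t : ℝ => (t : ℂ) ^ n * gaussKernel z t) (Ioi 0) := by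
  refine ((integrable_gaussKernel (z - I)).norm.const_mul (n.factorial : ℝ)).integrableOn.mono'
    (Continuous.aestronglyMeasurable (by have := continuous_gaussKernel z; fun_prop)) ?_
  refine (ae_restrict_mem measurableSet_Ioi).mono fun t (ht : 0 < t) => ?_
  have h1 := Real.pow_div_factorial_le_exp t ht.le n
  rw [div_le_iff₀' (by positivity)] at h1
  have h2 : Real.exp (-t ^ 2 / 2 - (z - I).im * t) =
      Real.exp t * Real.exp (-t ^ 2 / 2 - z.im * t) := by
    rw [← Real.exp_add]; congr 1; simp; ring
  rw [norm_mul, norm_pow, norm_real, Real.norm_of_nonneg ht.le, norm_gaussKernel, norm_gaussKernel,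
    h2, ← mul_assoc]
  gcongr

theorem hasDerivAt_gaussKernel_left (z : ℂ) (t : ℝ) :
    HasDerivAt (fun w => gaussKernel w t) (I * t * gaussKernel z t) z := by
  have h : HasDerivAt (fun w : ℂ => -(t : ℂ) ^ 2 / 2 + I * w * t) (I * t) z := by
    have := (((hasDerivAt_id z).const_mul I).mul_const (t : ℂ)).const_add (-(t : ℂ) ^ 2 / 2)
    simpa using this
  have := h.cexp
  rwa [mul_comm] at this

theorem hasDerivAt_gaussKernel_right (z : ℂ) (t : ℝ) :
    HasDerivAt (gaussKernel z) ((I * z - t) * gaussKernel z t) t := by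
  have h : HasDerivAt (fun s : ℂ => -s ^ 2 / 2 + I * z * s) (I * z - t) (t : ℂ) := by
    have := (((hasDerivAt_id (t : ℂ)).pow 2).neg.div_const 2).add
      ((hasDerivAt_id (t : ℂ)).const_mul (I * z))
    convert! this using 1
    simp
    ring
  have := h.cexp.comp_ofReal
  convert! this using 1
  exact mul_comm _ _

theorem hasDerivAt_gaussCauchy_integral (z : ℂ) :
    HasDerivAt gaussCauchy (∫ t in Ioi (0 : ℝ), t * gaussKernel z t) z := by
  have h := (hasDerivAt_integral_of_dominated_loc_of_deriv_le
    (μ := volume.restrict (Ioi (0 : ℝ))) (F := gaussKernel) (x₀ := z)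
    (F' := fun w t => I * t * gaussKernel w t)
    (bound := fun t => ‖(t : ℂ) ^ 1 * gaussKernel (z - I) t‖) (Metric.ball_mem_nhds z one_pos)
    (Eventually.of_forall fun w => (continuous_gaussKernel w).aestronglyMeasurable)
    (integrable_gaussKernel z).integrableOn
    (Continuous.aestronglyMeasurable (by have := continuous_gaussKernel z; fun_prop))
    ((ae_restrict_mem measurableSet_Ioi).mono fun t (ht : 0 < t) w hw => by
      have h1 := (abs_im_le_norm (w - z)).trans (mem_ball_iff_norm.1 hw).le
      rw [sub_im] at h1
      have h2 := (abs_le.1 h1).1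
      rw [norm_mul, norm_mul, norm_mul, norm_I, one_mul, pow_one, norm_gaussKernel,
        norm_gaussKernel]
      gcongr
      simp
      linarith)
    (integrableOn_pow_mul_gaussKernel 1 (z - I)).norm
    (ae_of_all _ fun t w _ => hasDerivAt_gaussKernel_left w t)).2
  have h2 := h.const_mul (-I)
  convert! h2 using 1
  rw [← integral_const_mul]
  congr 1
  ext t
  linear_combination (t * gaussKernel z t) * I_sq

/-- The differential equation `G' = 1 - z G`. -/
theorem hasDerivAt_gaussCauchy (z : ℂ) : HasDerivAt gaussCauchy (1 - z * gaussCauchy z) z := by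
  convert hasDerivAt_gaussCauchy_integral z using 1
  have i0 : IntegrableOn (gaussKernel z) (Ioi 0) := (integrable_gaussKernel z).integrableOn
  have i1 : IntegrableOn (fun t : ℝ => (t : ℂ) * gaussKernel z t) (Ioi 0) := by
    simpa using integrableOn_pow_mul_gaussKernel 1 z
  have hsplit : (fun t : ℝ => (I * z - t) * gaussKernel z t) =
      fun t : ℝ => I * z * gaussKernel z t - t * gaussKernel z t := by
    ext t; ring
  have hi : IntegrableOn (fun t : ℝ => (I * z - t) * gaussKernel z t) (Ioi 0) := by
    rw [hsplit]
    exact (i0.const_mul _).sub i1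
  have hlim := tendsto_zero_of_hasDerivAt_of_integrableOn_Ioi
    (fun t _ => hasDerivAt_gaussKernel_right z t) hi i0
  -- The differential equation is the integral of the `t`-derivative of the kernel, whose boundary
  -- term is `-1`.
  have key := integral_Ioi_of_hasDerivAt_of_tendsto'
    (fun t _ => hasDerivAt_gaussKernel_right z t) hi hlim
  rw [hsplit, integral_sub (i0.const_mul _) i1, integral_const_mul] at key
  have h0 : gaussKernel z 0 = 1 := by simp [gaussKernel]
  rw [h0] at key
  rw [gaussCauchy]
  linear_combination key

/-- Integrating the derivative of `t * gaussKernel z t` gives `z(zG - 1) = -i ∫ (1 - t²) gaussKernel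
z t`. For `Im z ≥ 0` the integrand is dominated by its modulus at `z = 0`. The added `1` in the
constant only makes it positive. -/
theorem exists_norm_mul_sub_one_le :
    ∃ C, 0 < C ∧ ∀ z : ℂ, 0 ≤ z.im → ‖z‖ * ‖z * gaussCauchy z - 1‖ ≤ C := by
  have i0 (z : ℂ) : IntegrableOn (gaussKernel z) (Ioi 0) := (integrable_gaussKernel z).integrableOn
  have i1 (z : ℂ) : IntegrableOn (fun t : ℝ => (t : ℂ) * gaussKernel z t) (Ioi 0) := by
    simpa using integrableOn_pow_mul_gaussKernel 1 z
  have i2 (z : ℂ) : IntegrableOn (fun t : ℝ => (1 - (t : ℂ) ^ 2) * gaussKernel z t) (Ioi 0) := by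
    simp_rw [sub_mul, one_mul]
    exact (i0 z).sub (integrableOn_pow_mul_gaussKernel 2 z)
  refine ⟨(∫ t in Ioi (0 : ℝ), ‖(1 - (t : ℂ) ^ 2) * gaussKernel 0 t‖) + 1,
    add_pos_of_nonneg_of_pos (integral_nonneg fun t => norm_nonneg _) one_pos, fun z hz => ?_⟩
  have hderiv (t : ℝ) : HasDerivAt (fun t : ℝ => (t : ℂ) * gaussKernel z t)
      ((1 - (t : ℂ) ^ 2) * gaussKernel z t + I * z * (t * gaussKernel z t)) t := by
    have := (hasDerivAt_id (t : ℂ)).comp_ofReal.mul (hasDerivAt_gaussKernel_right z t)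
    convert! this using 1
    simp only [id_eq]
    ring
  have hi := (i2 z).add ((i1 z).const_mul (I * z))
  have hlim := tendsto_zero_of_hasDerivAt_of_integrableOn_Ioi (fun t _ => hderiv t) hi (i1 z)
  have key := integral_Ioi_of_hasDerivAt_of_tendsto' (fun t _ => hderiv t) hi hlim
  rw [integral_add (i2 z) ((i1 z).const_mul _), integral_const_mul] at key
  have h1 : z * gaussCauchy z - 1 = -∫ t in Ioi (0 : ℝ), t * gaussKernel z t := by
    rw [← (hasDerivAt_gaussCauchy z).unique (hasDerivAt_gaussCauchy_integral z)]
    ring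
  have h2 : z * (z * gaussCauchy z - 1) =
      -I * ∫ t in Ioi (0 : ℝ), (1 - (t : ℂ) ^ 2) * gaussKernel z t := by
    rw [h1]
    simp only [ofReal_zero, zero_mul, sub_zero] at key
    linear_combination I * key - z * (∫ t in Ioi (0 : ℝ), t * gaussKernel z t) * I_sq
  rw [← norm_mul, h2, norm_mul, norm_neg, norm_I, one_mul]
  refine (norm_integral_le_integral_norm _).trans ?_
  refine le_trans (setIntegral_mono_on (i2 z).norm (i2 0).norm measurableSet_Ioi
    fun t (ht : 0 < t) => ?_) (by linarith)
  rw [norm_mul, norm_mul, norm_gaussKernel, norm_gaussKernel]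
  gcongr
  simpa

theorem one_div_sub_eq_integral {z : ℂ} (hz : 0 < z.im) (x : ℝ) :
    1 / (z - x) = -I * ∫ t in Ioi (0 : ℝ), cexp (I * (z - x) * t) := by
  have hne : z - (x : ℂ) ≠ 0 := by
    intro h
    have := congrArg im h
    simp at this
    linarith
  rw [integral_exp_mul_complex_Ioi (by simpa using hz)]
  have := I_ne_zero
  simp
  field_simp

/-- Write `1/(z - x)` as a Laplace integral and apply Fubini; the inner integral is the
characteristic function at `-t`, which supplies `exp (-t²/2)`. -/
theorem cauchyTransform_normalDistribution_one {z : ℂ} (hz : 0 < z.im) :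
    cauchyTransform (normalDistribution 0 1) z = gaussCauchy z := by
  change ∫ x : ℝ, 1 / (z - (x : ℂ)) ∂(gaussianReal 0 1) = _
  simp_rw [one_div_sub_eq_integral hz]
  have hint : Integrable (Function.uncurry fun x t : ℝ => cexp (I * (z - x) * t))
      ((gaussianReal 0 1).prod (volume.restrict (Ioi 0))) := by
    have h1 : IntegrableOn (fun t : ℝ => cexp (I * z * t)) (Ioi 0) :=
      integrableOn_exp_mul_complex_Ioi (by simpa using hz) 0
    refine ((integrable_const (1 : ℂ)).mul_prod h1).mono
      (Continuous.aestronglyMeasurable (by unfold Function.uncurry; fun_prop))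
      (ae_of_all _ fun p => le_of_eq ?_)
    simp [Function.uncurry, norm_exp]
  rw [integral_const_mul, integral_integral_swap hint, gaussCauchy]
  congr 1
  refine integral_congr_ae (ae_of_all _ fun t => ?_)
  have h2 := charFun_gaussianReal (μ := 0) (v := 1) (-t)
  rw [charFun_apply_real] at h2
  have h3 (x : ℝ) : cexp (I * (z - x) * t) = cexp (I * z * t) * cexp ((-t : ℝ) * x * I) := by
    rw [← Complex.exp_add]
    congr 1
    push_cast
    ring
  simp only [h3]
  rw [integral_const_mul, h2, gaussKernel, ← Complex.exp_add]
  congr 1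
  push_cast
  ring

/-! ### Sign and boundary values of the Gaussian Cauchy transform. -/

/-- A Cauchy transform maps the upper half-plane to the lower half-plane. -/
theorem im_cauchyTransform_neg (μ : ProbabilityMeasure ℝ) {z : ℂ} (hz : 0 < z.im) :
    (cauchyTransform μ z).im < 0 := by
  have him (x : ℝ) : (1 / (z - (x : ℂ))).im = -(z.im / normSq (z - x)) := by
    simp [div_eq_mul_inv]
  have hns (x : ℝ) : 0 < normSq (z - x) := by
    refine normSq_pos.2 fun h => ?_
    have := congrArg im h
    simp at this
    linarith
  have hint : Integrable (fun x : ℝ => 1 / (z - (x : ℂ))) (μ : Measure ℝ) := by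
    refine Integrable.of_bound (C := 1 / z.im) (Continuous.aestronglyMeasurable
      (continuous_const.div (by fun_prop) fun x => normSq_pos.1 (hns x))) (ae_of_all _ fun x => ?_)
    rw [norm_div, norm_one]
    gcongr
    have := abs_im_le_norm (z - x)
    simp only [sub_im, ofReal_im, sub_zero] at this
    exact (le_abs_self _).trans this
  have h1 : (cauchyTransform μ z).im = -∫ x : ℝ, z.im / normSq (z - x) ∂(μ : Measure ℝ) := by
    rw [← integral_neg, cauchyTransform]
    simp_rw [← him]
    exact (integral_im hint).symm
  have hpos (x : ℝ) : 0 < z.im / normSq (z - x) := div_pos hz (hns x)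
  rw [h1, neg_lt_zero, integral_pos_iff_support_of_nonneg (fun x => (hpos x).le)
    (hint.im.neg.congr (ae_of_all _ fun x => by
      change -(1 / (z - (x : ℂ))).im = _
      rw [him, neg_neg]))]
  have : Function.support (fun x : ℝ => z.im / normSq (z - x)) = univ :=
    eq_univ_of_forall fun x => (hpos x).ne'
  rw [this]
  simp

theorem hasDerivAt_re_gaussCauchy (x : ℝ) :
    HasDerivAt (fun x : ℝ => (gaussCauchy x).re) (1 - x * (gaussCauchy x).re) x := by
  have := (hasDerivAt_gaussCauchy x).real_of_complex
  simpa using this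

theorem hasDerivAt_im_gaussCauchy (x : ℝ) :
    HasDerivAt (fun x : ℝ => (gaussCauchy x).im) (-(x * (gaussCauchy x).im)) x := by
  have := ((hasDerivAt_gaussCauchy x).const_mul (-I)).real_of_complex
  simpa using this

theorem gaussCauchy_zero : gaussCauchy 0 = -I * (Real.sqrt (Real.pi / 2) : ℝ) := by
  rw [gaussCauchy]
  congr 1
  have h := integral_gaussian_Ioi (1 / 2)
  have h1 (t : ℝ) : gaussKernel 0 t = (Real.exp (-(1 / 2) * t ^ 2) : ℝ) := by
    rw [gaussKernel]
    push_cast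
    congr 1
    ring
  simp_rw [h1]
  rw [integral_complex_ofReal, h]
  congr 1
  rw [show Real.pi / (1 / 2) = (2 : ℝ) ^ 2 * (Real.pi / 2) by ring,
    Real.sqrt_mul (by positivity), Real.sqrt_sq (by norm_num)]
  ring

/-- By the differential equation `exp (x²/2) * Im G` is constant on the real line; its value at `0`
is a Gaussian integral. -/
theorem im_gaussCauchy_ofReal (x : ℝ) :
    (gaussCauchy x).im = -(Real.sqrt (Real.pi / 2) * (Real.exp (x ^ 2 / 2))⁻¹) := by
  have h1 (y : ℝ) : HasDerivAt (fun y : ℝ => Real.exp (y ^ 2 / 2) * (gaussCauchy y).im) 0 y := by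
    convert! (hasDerivAt_exp_half_sq y).mul (hasDerivAt_im_gaussCauchy y) using 1
    ring
  have := is_const_of_deriv_eq_zero (fun y => (h1 y).differentiableAt) (fun y => (h1 y).deriv) x 0
  simp [gaussCauchy_zero] at this
  rw [← div_eq_mul_inv, ← neg_div, eq_div_iff (Real.exp_pos _).ne', mul_comm, this]
  simp

theorem re_gaussCauchy_zero : (gaussCauchy (0 : ℝ)).re = 0 := by
  simp [gaussCauchy_zero]

theorem gaussCauchy_im_neg {z : ℂ} (hz : 0 ≤ z.im) : (gaussCauchy z).im < 0 := by
  rcases hz.eq_or_lt with h | h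
  · obtain ⟨x, rfl⟩ : ∃ x : ℝ, z = x := ⟨z.re, Complex.ext rfl (by simp [← h])⟩
    rw [im_gaussCauchy_ofReal, neg_lt_zero]
    positivity
  · rw [← cauchyTransform_normalDistribution_one h]
    exact im_cauchyTransform_neg _ h

theorem gaussCauchy_ne_zero {z : ℂ} (hz : 0 ≤ z.im) : gaussCauchy z ≠ 0 := fun h => by
  have := gaussCauchy_im_neg hz
  rw [h] at this
  simp at this

/-! ### The Gaussian self-energy: boundedness and boundary monotonicity. -/

/-- The extension of the self-energy of the standard normal distribution to the closed upper
half-plane. -/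
noncomputable def gaussSelfEnergy (z : ℂ) : ℂ :=
  z - 1 / gaussCauchy z

theorem differentiableAt_gaussSelfEnergy {z : ℂ} (hz : 0 ≤ z.im) :
    DifferentiableAt ℂ gaussSelfEnergy z :=
  differentiableAt_id.sub ((differentiableAt_const 1).div
    (hasDerivAt_gaussCauchy z).differentiableAt (gaussCauchy_ne_zero hz))

/-- Here `K = (zG - 1)/G`. For large `|z|` the numerator is at most `C/|z|`, hence at most `1/2`,
which forces `|G| ≥ 1/(2|z|)` and `|K| ≤ 2C`. -/
theorem exists_norm_gaussSelfEnergy_le : ∃ B, ∀ z : ℂ, 0 ≤ z.im → ‖gaussSelfEnergy z‖ ≤ B := by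
  obtain ⟨C, hC, h⟩ := exists_norm_mul_sub_one_le
  refine exists_bound_of_continuousOn_of_tail (M := 2 * C) (R := 2 * C + 1)
    (fun z hz => (differentiableAt_gaussSelfEnergy hz).continuousAt.continuousWithinAt)
    fun z hz hR => ?_
  have h1 := h z hz
  have hz0 : 0 < ‖z‖ := by linarith
  have hG := gaussCauchy_ne_zero hz
  have hG0 : 0 < ‖gaussCauchy z‖ := norm_pos_iff.2 hG
  have h2 : ‖z * gaussCauchy z - 1‖ ≤ 1 / 2 := by
    by_contra! hlt
    nlinarith
  have h3 : 1 / 2 ≤ ‖z‖ * ‖gaussCauchy z‖ := by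
    have := norm_sub_norm_le (1 : ℂ) (z * gaussCauchy z)
    rw [norm_sub_rev, norm_one, norm_mul] at this
    linarith
  have h4 : gaussSelfEnergy z = (z * gaussCauchy z - 1) / gaussCauchy z := by
    rw [gaussSelfEnergy]
    field_simp
  rw [h4, norm_div, div_le_iff₀ hG0]
  have h5 : ‖z‖ * ‖z * gaussCauchy z - 1‖ ≤ ‖z‖ * (2 * C * ‖gaussCauchy z‖) := by nlinarith
  exact le_of_mul_le_mul_left h5 hz0

theorem im_one_div_gaussCauchy_pos {z : ℂ} (hz : 0 ≤ z.im) : 0 < (1 / gaussCauchy z).im := by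
  rw [one_div, inv_im]
  exact div_pos (neg_pos.2 (gaussCauchy_im_neg hz)) (normSq_pos.2 (gaussCauchy_ne_zero hz))

theorem strictMono_div_im_one_div_gaussCauchy :
    StrictMono fun x : ℝ => x / (1 / gaussCauchy x).im := by
  have hP (x : ℝ) : -(gaussCauchy x).im ≠ 0 :=
    (neg_pos.2 (gaussCauchy_im_neg (z := x) (by simp))).ne'
  have heq : (fun x : ℝ => x / (1 / gaussCauchy x).im) = fun x : ℝ =>
      x * ((gaussCauchy x).re ^ 2 + (gaussCauchy x).im ^ 2) / -(gaussCauchy x).im := by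
    ext x
    rw [one_div, inv_im, normSq_apply]
    field_simp
  rw [heq]
  refine strictMono_of_hasDerivAt_pos (fun x => (((hasDerivAt_id x).mul
    (((hasDerivAt_re_gaussCauchy x).pow 2).add ((hasDerivAt_im_gaussCauchy x).pow 2))).div
      (hasDerivAt_im_gaussCauchy x).neg (hP x))) fun x => ?_
  have key := key_inequality hasDerivAt_re_gaussCauchy re_gaussCauchy_zero x
  have h1 : Real.pi / 2 * (Real.exp (x ^ 2 / 2))⁻¹ ^ 2 = (gaussCauchy x).im ^ 2 := by
    rw [im_gaussCauchy_ofReal, neg_sq, mul_pow, Real.sq_sqrt (by positivity)]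
  rw [h1] at key
  have hP' : 0 < -(gaussCauchy x).im := neg_pos.2 (gaussCauchy_im_neg (z := x) (by simp))
  refine lt_of_lt_of_eq (div_pos key hP') ?_
  have := hP x
  have h2 : (gaussCauchy x).im ≠ 0 := neg_ne_zero.1 this
  simp only [Pi.add_apply, Pi.pow_apply, Pi.mul_apply, id_eq]
  field_simp
  push_cast
  ring

/-- For `x ≠ 0` this compares the increasing function at `x` and `x / c`, the order depending on the
sign of `x`; at `0` it is positivity and `c < 1`. -/
theorem mul_im_one_div_gaussCauchy_lt {c : ℝ} (hc : 0 < c) (hc1 : c < 1) (x : ℝ) :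
    c * (1 / gaussCauchy (x / c : ℝ)).im < (1 / gaussCauchy x).im := by
  have hq (y : ℝ) : 0 < (1 / gaussCauchy y).im := im_one_div_gaussCauchy_pos (by simp)
  have hqx := hq x
  have hqc := hq (x / c)
  rcases lt_trichotomy x 0 with hx | rfl | hx
  · have h : x / c < x := by rw [div_lt_iff₀ hc]; nlinarith
    have := strictMono_div_im_one_div_gaussCauchy h
    simp only at this
    rw [div_div, div_lt_div_iff₀ (by positivity) hqx] at this
    exact lt_of_mul_lt_mul_of_nonpos_left this hx.le
  · simp only [zero_div] at *
    nlinarith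
  · have h : x < x / c := by rw [lt_div_iff₀ hc]; nlinarith
    have := strictMono_div_im_one_div_gaussCauchy h
    simp only at this
    rw [div_div, div_lt_div_iff₀ hqx (by positivity)] at this
    exact lt_of_mul_lt_mul_left this hx.le

/-! ### Bounded functions as self-energies. -/

/-- The Phragmen–Lindelöf principle for the imaginary part of a bounded function in the upper
half-plane. -/
theorem im_nonpos_of_bounded {f : ℂ → ℂ} (hd : ∀ z : ℂ, 0 ≤ z.im → DifferentiableAt ℂ f z) {B : ℝ}
    (hB : ∀ z : ℂ, 0 ≤ z.im → ‖f z‖ ≤ B) (hre : ∀ x : ℝ, (f x).im ≤ 0) {z : ℂ} (hz : 0 ≤ z.im) :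
    (f z).im ≤ 0 := by
  have hnorm (w : ℂ) : ‖cexp (-I * f w)‖ = Real.exp (f w).im := by
    rw [norm_exp]; simp
  have hbd (w : ℂ) (hw : 0 ≤ w.re) : ‖cexp (-I * f (I * w))‖ ≤ Real.exp B := by
    rw [hnorm]
    exact Real.exp_le_exp.2 (((le_abs_self _).trans (abs_im_le_norm _)).trans
      (hB _ (by simpa using hw)))
  -- The function `exp (-i f)` has modulus `exp (Im f)`, at most `1` on the boundary; `w ↦ I * w`
  -- turns the right half-plane into the upper one.
  have := PhragmenLindelof.right_half_plane_of_bounded_on_real (C := 1)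
    (f := fun w => cexp (-I * f (I * w))) (z := -I * z) ?_ ?_ ?_ ?_ (by simpa using hz)
  · have hw : I * (-I * z) = z := by linear_combination (-z) * I_sq
    rw [hw, hnorm] at this
    simpa using this
  · refine DifferentiableOn.diffContOnCl fun w hw => ?_
    rw [closure_setOfPred_lt_re] at hw
    refine DifferentiableAt.differentiableWithinAt ?_
    have h1 : DifferentiableAt ℂ f (I * w) := hd _ (by simpa using hw)
    have h2 : DifferentiableAt ℂ (fun w => f (I * w)) w :=
      h1.comp w (differentiableAt_id.const_mul I)
    exact (h2.const_mul (-I)).cexp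
  · refine ⟨1, one_lt_two, 0, Asymptotics.IsBigO.of_bound (Real.exp B) ?_⟩
    refine eventually_inf_principal.2 (Eventually.of_forall fun w (hw : 0 < w.re) => ?_)
    simpa using hbd w hw.le
  · exact isBoundedUnder_of_eventually_le (a := Real.exp B)
      ((eventually_ge_atTop 0).mono fun x hx => hbd x (by simpa using hx))
  · intro x
    have hw : I * (x * I) = ((-x : ℝ) : ℂ) := by push_cast; linear_combination x * I_sq
    rw [hw, hnorm]
    exact Real.exp_le_one_iff.2 (hre _)

/-- A bounded function on the closed upper half-plane with negative imaginary part on the real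
line is the self-energy of a probability measure. -/
theorem exists_selfEnergy_eq {f : ℂ → ℂ} (hd : ∀ z : ℂ, 0 ≤ z.im → DifferentiableAt ℂ f z) {B : ℝ}
    (hB : ∀ z : ℂ, 0 ≤ z.im → ‖f z‖ ≤ B) (hre : ∀ x : ℝ, (f x).im < 0) :
    ∃ μ : ProbabilityMeasure ℝ, ∀ z : ℂ, 0 < z.im → selfEnergy μ z = f z := by
  have him (z : ℂ) (hz : 0 ≤ z.im) : 0 < (z - f z).im := by
    rw [sub_im]
    rcases hz.eq_or_lt with h | h
    · obtain ⟨x, rfl⟩ : ∃ x : ℝ, z = x := ⟨z.re, Complex.ext rfl (by simp [← h])⟩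
      have := hre x
      rw [ofReal_im]
      linarith
    · have := im_nonpos_of_bounded hd hB (fun x => (hre x).le) hz
      linarith
  have hne (z : ℂ) (hz : 0 ≤ z.im) : z - f z ≠ 0 := fun h => by
    have := him z hz
    rw [h] at this
    simp at this
  have hB0 : 0 ≤ B := (norm_nonneg _).trans (hB 0 (by simp))
  set g : ℂ → ℂ := fun z => 1 / (z - f z) with hg
  have hgd (z : ℂ) (hz : 0 ≤ z.im) : DifferentiableAt ℂ g z :=
    (differentiableAt_const 1).div (differentiableAt_id.sub (hd z hz)) (hne z hz)
  have hgc : ContinuousOn g {z | 0 ≤ z.im} := fun z hz =>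
    (hgd z hz).continuousAt.continuousWithinAt
  obtain ⟨C, hC⟩ : ∃ C, ∀ z : ℂ, 0 ≤ z.im → ‖((1 + ‖z‖ : ℝ) : ℂ) * g z‖ ≤ C := by
    refine exists_bound_of_continuousOn_of_tail
      (ContinuousOn.mul (Continuous.continuousOn (by fun_prop)) hgc)
      (M := 4) (R := 2 * B + 1) fun z hz hR => ?_
    have h1 : ‖z‖ / 2 ≤ ‖z - f z‖ := by
      have := norm_sub_norm_le z (f z)
      have := hB z hz
      linarith
    have hpos : 0 ≤ 1 + ‖z‖ := by positivity
    rw [norm_mul, norm_real, Real.norm_of_nonneg hpos, norm_div, norm_one, mul_one_div,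
      div_le_iff₀ (norm_pos_iff.2 (hne z hz))]
    linarith
  have hb (z : ℂ) (hz : 0 ≤ z.im) : ‖g z‖ ≤ C / (1 + ‖z‖) := by
    have hpos : 0 < 1 + ‖z‖ := by positivity
    have := hC z hz
    rw [norm_mul, norm_real, Real.norm_of_nonneg hpos.le] at this
    rwa [le_div_iff₀' hpos]
  have hlim : Tendsto (fun y : ℝ => y * I * g (y * I)) atTop (𝓝 1) := by
    have h0 : Tendsto (fun y : ℝ => f (y * I) / (y * I)) atTop (𝓝 0) := by
      refine squeeze_zero_norm' ?_ (tendsto_const_nhds (x := B).div_atTop tendsto_id)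
      filter_upwards [eventually_gt_atTop 0] with y hy
      rw [norm_div, norm_mul, norm_I, mul_one, norm_real, Real.norm_of_nonneg hy.le]
      exact div_le_div_of_nonneg_right (hB _ (by simpa using hy.le)) hy.le
    have h1 : Tendsto (fun y : ℝ => (1 - f (y * I) / (y * I))⁻¹) atTop (𝓝 1) := by
      simpa using (h0.const_sub 1).inv₀ (by simp)
    refine h1.congr' ?_
    filter_upwards [eventually_gt_atTop 0] with y hy
    have hyI : (y : ℂ) * I ≠ 0 := mul_ne_zero (by exact_mod_cast hy.ne') I_ne_zero
    have h2 := hne (y * I) (by simpa using hy.le)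
    rw [hg, mul_one_div, ← inv_div (_ - _), sub_div, div_self hyI]
  obtain ⟨μ, hμ⟩ := exists_probabilityMeasure_cauchyTransform_eq hgc
    (fun z hz => (hgd z (le_of_lt hz)).differentiableWithinAt) hb (fun x => by
      rw [hg]
      simp only
      rw [one_div, inv_im]
      exact (div_neg_of_neg_of_pos (neg_neg_of_pos (him x (by simp)))
        (normSq_pos.2 (hne x (by simp)))).le) hlim
  refine ⟨μ, fun z hz => ?_⟩
  rw [selfEnergy, fTransform, hμ z hz, hg]
  simp

/-! ### Dilations and the conclusion. -/

theorem cauchyTransform_dilation {a : ℝ} (ha : 0 < a) (μ : ProbabilityMeasure ℝ) (z : ℂ) :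
    cauchyTransform (dilation a μ) z = (a : ℂ)⁻¹ * cauchyTransform μ (z / a) := by
  have ha' : (a : ℂ) ≠ 0 := by exact_mod_cast ha.ne'
  have hemb : MeasurableEmbedding (fun x : ℝ => a * x) :=
    (Homeomorph.mulLeft₀ a ha.ne').measurableEmbedding
  change ∫ x : ℝ, 1 / (z - (x : ℂ)) ∂((μ : Measure ℝ).map (fun x => a * x)) = _
  rw [hemb.integral_map, cauchyTransform, ← integral_const_mul]
  refine integral_congr_ae (ae_of_all _ fun x => ?_)
  simp only
  rw [one_div, one_div, ← mul_inv]
  congr 1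
  push_cast
  field_simp

theorem selfEnergy_dilation {a : ℝ} (ha : 0 < a) (μ : ProbabilityMeasure ℝ) (z : ℂ) :
    selfEnergy (dilation a μ) z = a * selfEnergy μ (z / a) := by
  have ha' : (a : ℂ) ≠ 0 := by exact_mod_cast ha.ne'
  rw [selfEnergy, selfEnergy, fTransform, fTransform, cauchyTransform_dilation ha, one_div, mul_inv,
    inv_inv]
  field_simp

theorem div_ofReal_im_pos {a : ℝ} (ha : 0 < a) {z : ℂ} (hz : 0 < z.im) : 0 < (z / a).im := by
  rw [div_ofReal_im]
  exact div_pos hz ha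

/-- All self-energies scale by the same rule and dilations commute, so the component of the dilated
measure is the dilated component. -/
theorem IsBooleanSelfdecomposable.dilation {μ : ProbabilityMeasure ℝ}
    (h : IsBooleanSelfdecomposable μ) {a : ℝ} (ha : 0 < a) :
    IsBooleanSelfdecomposable (dilation a μ) := by
  intro c hc hc1
  obtain ⟨ν, hν⟩ := h c hc hc1
  refine ⟨_root_.dilation a ν, fun z hz => ?_⟩
  have h1 := hν (z / a) (div_ofReal_im_pos ha hz)
  rw [selfEnergy_dilation hc] at h1
  rw [selfEnergy_dilation ha, selfEnergy_dilation hc, selfEnergy_dilation ha,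
    selfEnergy_dilation ha, h1, div_right_comm]
  ring

theorem selfEnergy_normalDistribution_one {z : ℂ} (hz : 0 < z.im) :
    selfEnergy (normalDistribution 0 1) z = gaussSelfEnergy z := by
  rw [selfEnergy, fTransform, cauchyTransform_normalDistribution_one hz, gaussSelfEnergy]

theorem isBooleanSelfdecomposable_normalDistribution_one :
    IsBooleanSelfdecomposable (normalDistribution 0 1) := by
  intro c hc hc1
  obtain ⟨B, hB⟩ := exists_norm_gaussSelfEnergy_le
  have him (z : ℂ) (hz : 0 ≤ z.im) : 0 ≤ (z / c).im := by
    rw [div_ofReal_im]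
    exact div_nonneg hz hc.le
  obtain ⟨ν, hν⟩ := exists_selfEnergy_eq
    (f := fun z => gaussSelfEnergy z - c * gaussSelfEnergy (z / c)) (B := B + c * B)
    (fun z hz => (differentiableAt_gaussSelfEnergy hz).sub
      (((differentiableAt_gaussSelfEnergy (him z hz)).fun_comp' z
        (differentiableAt_id.div_const _)).const_mul _))
    (fun z hz => by
      refine (norm_sub_le _ _).trans (add_le_add (hB z hz) ?_)
      rw [norm_mul, norm_real, Real.norm_of_nonneg hc.le]
      exact mul_le_mul_of_nonneg_left (hB _ (him z hz)) hc.le)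
    (fun x => by
      have := mul_im_one_div_gaussCauchy_lt hc hc1 x
      rw [← ofReal_div]
      simp only [gaussSelfEnergy, sub_im, im_ofReal_mul, ofReal_im]
      linarith)
  refine ⟨ν, fun z hz => ?_⟩
  rw [selfEnergy_dilation hc, selfEnergy_normalDistribution_one hz,
    selfEnergy_normalDistribution_one (div_ofReal_im_pos hc hz), hν z hz]
  ring

theorem normalDistribution_eq_dilation (v : ℝ≥0) :
    normalDistribution 0 v = dilation (Real.sqrt v) (normalDistribution 0 1) := by
  apply Subtype.ext
  change gaussianReal 0 v = (gaussianReal 0 1).map (fun x => Real.sqrt v * x)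
  rw [gaussianReal_map_const_mul, mul_zero, mul_one]
  congr 1
  ext
  simp

theorem mainTheorem4 (v : ℝ≥0) (hv : 0 < v) :
    IsBooleanSelfdecomposable (normalDistribution 0 v) := by
  rw [normalDistribution_eq_dilation]
  exact isBooleanSelfdecomposable_normalDistribution_one.dilation
    (Real.sqrt_pos.2 (by exact_mod_cast hv))
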